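/- For $n\ge 0$ let the eigenvalues $(\lambda_1,\dots,\lambda_n)\in\mathbb{R}^n$ of the $n\times n$ Gaussian Unitary Ensemble be distributed with joint probability density $$\frac{1}{N_n}\,e^{-\sum_{j=1}^n\lambda_j^2}\prod_{1\le j<k\le n}(\lambda_j-\lambda_k)^2,\qquad N_n=\int_{\mathbb{R}^n}e^{-\sum_{j=1}^n\lambda_j^2}\prod_{1\le j<k\le n}(\lambda_j-\lambda_k)^2\,d\lambda_1\cdots d\lambda_n$$ (with $N_0=1$), and let $p(n_+,n)$ be the probability that exactly $n_+$ of the $n$ eigenvalues are positive. Let $$\Delta_n=\sum_{n_+=0}^{n}\bigl(n_+-\langle n_+\rangle\bigr)^2\,p(n_+,n),\qquad \langle n_+\rangle=\sum_{n_+=0}^{n}n_+\,p(n_+,n),$$ be the variance of the index (the number of positive eigenvalues), and let $\psi=\Gamma'/\Gamma$ be the digamma function. Then, for all $n\ge 0$, with $m=\lfloor n/2\rfloor$, $$\Delta_n=\frac n4-\frac{n}{2\pi^2}\sum_{l=0}^{m}\frac{\Gamma^2(l+\frac12)}{\Gamma^2(l+1)}\Bigl[\psi(m+\tfrac12)-\psi(m+1)-\psi(l+\tfrac12)+\psi(l+1)\Bigr]$$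 and $$\Delta_n=\frac{n}{2\pi^2}\Bigl\{\bigl[\psi(m+1)-\psi(m+\tfrac12)\bigr]\sum_{l=0}^{m}\frac{\Gamma^2(l+\frac12)}{\Gamma^2(l+1)}+\sum_{l=m+1}^{\infty}\frac{\Gamma^2(l+\frac12)}{\Gamma^2(l+1)}\bigl[\psi(l+1)-\psi(l+\tfrac12)\bigr]\Bigr\},$$ where the infinite series converges. Moreover $$\sum_{l=0}^{\infty}\frac{\Gamma^2(l+\frac12)}{\Gamma^2(l+1)}\bigl[\psi(l+1)-\psi(l+\tfrac12)\bigr]=\frac{\pi^2}{2}.$$ -/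

import Mathlib

open scoped BigOperators

noncomputable section

namespace GUEIndex

/-- The unnormalised joint density `exp(-∑ xⱼ²) ∏_{j<k} (xⱼ - xₖ)²` of the eigenvalues of an
`n × n` matrix from the Gaussian Unitary Ensemble. -/
def weight (n : ℕ) (x : Fin n → ℝ) : ℝ :=
  Real.exp (-∑ j, x j ^ 2) * ∏ j, ∏ k ∈ Finset.Ioi j, (x j - x k) ^ 2

/-- The normalisation `N_n`, the integral of the unnormalised joint density over `ℝⁿ`
(for `n = 0` the space is one point of mass one, and `N_0 = 1`). -/
def normalisation (n : ℕ) : ℝ :=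
  ∫ x : Fin n → ℝ, weight n x

/-- The index of an eigenvalue configuration: the number of positive eigenvalues. -/
def index {n : ℕ} (x : Fin n → ℝ) : ℕ :=
  {j : Fin n | 0 < x j}.ncard

/-- The probability `p(k, n)` that exactly `k` of the `n` eigenvalues are positive. -/
def indexProb (k n : ℕ) : ℝ :=
  (∫ x in {x : Fin n → ℝ | index x = k}, weight n x) / normalisation n

/-- The mean `⟨n₊⟩` of the index. -/
def indexMean (n : ℕ) : ℝ :=
  ∑ k ∈ Finset.range (n + 1), (k : ℝ) * indexProb k n

/-- The variance `Δ_n = ⟨(n₊ - ⟨n₊⟩)²⟩` of the index. -/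
def indexVariance (n : ℕ) : ℝ :=
  ∑ k ∈ Finset.range (n + 1), ((k : ℝ) - indexMean n) ^ 2 * indexProb k n

/-- The digamma function `ψ = Γ'/Γ` at a real argument (where its value is real). -/
def psi (x : ℝ) : ℝ :=
  (Complex.digamma (x : ℂ)).re

/-- The coefficient `Γ(l + 1/2)² / Γ(l + 1)²`. -/
def gammaRatioSq (l : ℕ) : ℝ :=
  Real.Gamma ((l : ℝ) + 1 / 2) ^ 2 / Real.Gamma ((l : ℝ) + 1) ^ 2

end GUEIndex

end

/-!
The eigenvalues form a determinantal process, so the probability generating function of the index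
is a determinant. With `hₙ` the monic Hermite polynomials for `exp (-x ^ 2)`, the joint density is
a squared determinant of the `hⱼ (xᵢ)` times the Gaussian weights (`weight_eq_det`), and Andréief's
identity (`integral_det_sq_mul_prod`) gives `∑ k, p(k, n) sᵏ = det (1 + (s - 1) A)`
(`sum_indexProb_mul_pow`), where `A` is the symmetric matrix of the inner products over `(0, ∞)` of
the first `n` normalised Hermite functions. Diagonalising `A`, the index is distributed like a sum
of independent Bernoulli variables whose parameters are the eigenvalues of `A`, and
`Δₙ = tr A - tr A²` (`indexVariance_eq_trace`).

The entries of `A` are explicit. The diagonal is `1/2`; off the diagonal, the Wronskian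
`hⱼ' hₖ - hⱼ hₖ'` times the weight is a primitive of a multiple of `hⱼ hₖ` times the weight, so only
boundary values at `0` survive (`gaussInt_Ioi_hermiteMonic`). These vanish when `j` and `k` have the
same parity, and otherwise the squared entry is an explicit multiple of a product of two of the
normalised central binomial coefficients `u r = centralBinom r / 4 ^ r = Γ(r + 1/2) / (√π Γ(r + 1))`
(`overlap_even_odd_sq`). Hence
`Δₙ₊₁ - Δₙ = 1/4 - 2 ∑_{j<n} A_{jn}²`, where the last sum is `evenRow` or `oddRow`, up to a factor,
according to the parity of `n`.

Those row sums are convolutions of `u` with the reciprocal odd squares. The differential equation of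
`∑ u r x ^ (2 r) = (1 - x ^ 2) ^ (-1/2)`, read off coefficientwise (`centralConv_recurrence`), yields
two identities expressing `∑_{l ≤ m} (u l)²` through consecutive row sums (`evenRow_succ`,
`oddRow_sub_evenRow`). They give `Δₙ = n/4 - (n/π) evenRow ⌊n/2⌋` by induction on `n`
(`eq_evenRow_of_increment`), and a summation by parts turns `evenRow` into the digamma sum
(`sum_centralRatio_sq_mul_sub`), since `ψ(l+1) - ψ(l+1/2)` decreases by `1 / ((2l+1)(l+1))` at each
step.

The value `π² / 2` of the infinite series is the limit of `2 π evenRow m`, obtained by dominated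
convergence from Wallis' product and `∑ 1 / (2k+1)² = π² / 8` (`tendsto_evenRow`); with it, the term
`n/4` of the first closed form becomes a multiple of the whole series, which gives the second one.
-/

noncomputable section

namespace GUEIndex

open Finset Filter Topology MeasureTheory Polynomial Matrix

/-! ### Convolutions of central binomial coefficients -/

/-- The central binomial coefficient divided by `4 ^ r`, that is `Γ(r + 1/2) / (√π Γ(r + 1))`. -/
def centralRatio (r : ℕ) : ℝ := (Nat.centralBinom r : ℝ) / 4 ^ r

lemma centralRatio_zero : centralRatio 0 = 1 := by simp [centralRatio]

lemma centralRatio_pos (r : ℕ) : 0 < centralRatio r := by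
  unfold centralRatio
  have := Nat.centralBinom_pos r
  positivity

lemma centralRatio_succ (r : ℕ) :
    (2 * (r : ℝ) + 2) * centralRatio (r + 1) = (2 * (r : ℝ) + 1) * centralRatio r := by
  have h : ((r : ℝ) + 1) * Nat.centralBinom (r + 1) = 2 * (2 * r + 1) * Nat.centralBinom r := by
    exact_mod_cast Nat.succ_mul_centralBinom_succ r
  unfold centralRatio
  field_simp
  rw [pow_succ]
  linear_combination 2 * 4 ^ r * h

/-- The convolution of `centralRatio` with a sequence `c`: the coefficients of
`(1 - x) ^ (-1/2) * ∑ c k x ^ k`. -/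
def centralConv (c : ℕ → ℝ) (m : ℕ) : ℝ :=
  ∑ r ∈ range (m + 1), centralRatio r * c (m - r)

/-- The first-order differential equation of `(1 - x ^ 2) ^ (-1/2)`, read off coefficientwise. -/
lemma centralConv_recurrence (c : ℕ → ℝ) (m : ℕ) :
    (2 * (m : ℝ) + 3) * centralConv c (m + 1) - (2 * (m : ℝ) + 2) * centralConv c m =
      centralConv (fun k => (2 * (k : ℝ) + 1) * c k) (m + 1) -
        centralConv (fun k => (2 * (k : ℝ) + 1) * c k) m := by
  have h1 : ∑ r ∈ range (m + 1 + 1), 2 * (r : ℝ) * centralRatio r * c (m + 1 - r) =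
      ∑ r ∈ range (m + 1), (2 * (r : ℝ) + 1) * centralRatio r * c (m - r) := by
    rw [sum_range_succ']
    simp only [Nat.cast_zero, mul_zero, zero_mul, add_zero]
    refine sum_congr rfl fun r _ => ?_
    have := centralRatio_succ r
    rw [show m + 1 - (r + 1) = m - r by omega]
    push_cast
    linear_combination c (m - r) * this
  have h2 : (2 * (m : ℝ) + 3) * centralConv c (m + 1) =
      centralConv (fun k => (2 * (k : ℝ) + 1) * c k) (m + 1) +
        ∑ r ∈ range (m + 1 + 1), 2 * (r : ℝ) * centralRatio r * c (m + 1 - r) := by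
    simp only [centralConv, mul_sum, ← sum_add_distrib]
    refine sum_congr rfl fun r hr => ?_
    rw [Nat.cast_sub (by simp at hr; omega)]
    push_cast; ring
  have h3 : (2 * (m : ℝ) + 2) * centralConv c m =
      centralConv (fun k => (2 * (k : ℝ) + 1) * c k) m +
        ∑ r ∈ range (m + 1), (2 * (r : ℝ) + 1) * centralRatio r * c (m - r) := by
    simp only [centralConv, mul_sum, ← sum_add_distrib]
    refine sum_congr rfl fun r hr => ?_
    rw [Nat.cast_sub (by simp at hr; omega)]
    ring
  rw [h2, h3, h1]; ring

/-- The convolution of `centralRatio` with the reciprocals of the odd numbers. -/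
def convOdd (m : ℕ) : ℝ := centralConv (fun k => 1 / (2 * (k : ℝ) + 1)) m

/-- The convolution of `centralRatio` with the reciprocals of the odd squares. -/
def convOddSq (m : ℕ) : ℝ := centralConv (fun k => 1 / (2 * (k : ℝ) + 1) ^ 2) m

lemma convOdd_succ (m : ℕ) :
    (2 * (m : ℝ) + 3) * convOdd (m + 1) - (2 * (m : ℝ) + 2) * convOdd m = centralRatio (m + 1) := by
  unfold convOdd
  rw [centralConv_recurrence]
  have : ∀ k : ℕ, (2 * (k : ℝ) + 1) * (1 / (2 * (k : ℝ) + 1)) = 1 := fun k => by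
    field_simp
  simp only [this, centralConv]
  rw [sum_range_succ]
  simp

lemma convOddSq_succ (m : ℕ) :
    (2 * (m : ℝ) + 3) * convOddSq (m + 1) - (2 * (m : ℝ) + 2) * convOddSq m =
      convOdd (m + 1) - convOdd m := by
  unfold convOdd convOddSq
  rw [centralConv_recurrence]
  have : ∀ k : ℕ, (2 * (k : ℝ) + 1) * (1 / (2 * (k : ℝ) + 1) ^ 2) = 1 / (2 * (k : ℝ) + 1) :=
    fun k => by field_simp
  simp only [this]

/-- The convolution with odd reciprocals sums the squares of `centralRatio`. -/
lemma sum_centralRatio_sq (m : ℕ) :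
    (2 * (m : ℝ) + 1) * centralRatio m * convOdd m = ∑ l ∈ range (m + 1), centralRatio l ^ 2 := by
  induction m with
  | zero => simp [convOdd, centralConv, centralRatio_zero]
  | succ m ih =>
    rw [sum_range_succ, ← ih]
    push_cast
    linear_combination centralRatio (m + 1) * convOdd_succ m + convOdd m * centralRatio_succ m

/-- Up to the factor `1 / (2 π)`, the sum of the squared half-line overlaps of the Hermite
function of degree `2 m` with those of lower degree. -/
def evenRow (m : ℕ) : ℝ :=
  centralRatio m * ∑ s ∈ range m,
    (2 * (s : ℝ) + 1) * centralRatio s / (2 * (m : ℝ) - 2 * s - 1) ^ 2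

/-- Up to the factor `1 / (2 π)`, the sum of the squared half-line overlaps of the Hermite
function of degree `2 m + 1` with those of lower degree. -/
def oddRow (m : ℕ) : ℝ :=
  (2 * (m : ℝ) + 1) * centralRatio m * ∑ r ∈ range (m + 1),
    centralRatio r / (2 * (m : ℝ) + 1 - 2 * r) ^ 2

lemma oddRow_eq (m : ℕ) : oddRow m = (2 * (m : ℝ) + 1) * centralRatio m * convOddSq m := by
  unfold oddRow convOddSq centralConv
  congr 1
  refine sum_congr rfl fun r hr => ?_
  dsimp only
  rw [Nat.cast_sub (by simp at hr; omega)]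
  rw [show 2 * ((m : ℝ) - r) + 1 = 2 * (m : ℝ) + 1 - 2 * r by ring]
  ring

/-- Since `2 s + 1 = (2 m + 2) - (2 m + 1 - 2 s)`, the even row of index `m + 1` splits into
`convOddSq m`, which is the odd row, and `convOdd m`, which sums the squares. -/
lemma evenRow_succ (m : ℕ) :
    (2 * (m : ℝ) + 2) * (oddRow m - evenRow (m + 1)) = ∑ l ∈ range (m + 1), centralRatio l ^ 2 := by
  have h : evenRow (m + 1) = centralRatio (m + 1) * ((2 * m + 2) * convOddSq m - convOdd m) := by
    unfold evenRow convOddSq convOdd centralConv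
    rw [mul_sum _ _ (2 * (m : ℝ) + 2), ← sum_sub_distrib]
    congr 1
    refine sum_congr rfl fun r hr => ?_
    have hr : r ≤ m := by simp at hr; omega
    have : (r : ℝ) ≤ m := by exact_mod_cast hr
    dsimp only
    rw [Nat.cast_sub hr]
    have h1 : 2 * (m : ℝ) - 2 * r + 1 ≠ 0 := by linarith
    rw [show 2 * ((m + 1 : ℕ) : ℝ) - 2 * r - 1 = 2 * (m : ℝ) - 2 * r + 1 by push_cast; ring,
      show 2 * ((m : ℝ) - r) + 1 = 2 * (m : ℝ) - 2 * r + 1 by ring]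
    field_simp
    ring
  rw [h, oddRow_eq, ← sum_centralRatio_sq]
  linear_combination (convOdd m - (2 * m + 2) * convOddSq m) * centralRatio_succ m

/-- This is the recurrence `convOddSq_succ`, with the even row rewritten by
`evenRow_succ`. -/
lemma oddRow_sub_evenRow (m : ℕ) :
    (2 * (m : ℝ) + 1) * (oddRow m - evenRow m) = ∑ l ∈ range (m + 1), centralRatio l ^ 2 := by
  cases m with
  | zero => simp [oddRow, evenRow, centralRatio_zero]
  | succ k =>
    have h1 := evenRow_succ k
    rw [← sum_centralRatio_sq] at h1 ⊢
    have h0 : (2 * (k : ℝ) + 2) ≠ 0 := by positivity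
    have h2 : evenRow (k + 1) = oddRow k - centralRatio (k + 1) * convOdd k := by
      apply mul_left_cancel₀ h0
      linear_combination -h1 + convOdd k * centralRatio_succ k
    rw [h2, oddRow_eq, oddRow_eq]
    push_cast
    linear_combination (2 * (k : ℝ) + 3) * (centralRatio (k + 1) * convOddSq_succ k
      + convOddSq k * centralRatio_succ k)

/-- The relation needed in passing from `2 m + 1` to `2 m + 2` eigenvalues. -/
lemma evenRow_step (m : ℕ) :
    (2 * (m : ℝ) + 2) * evenRow (m + 1) = (2 * (m : ℝ) + 1) * evenRow m + oddRow m := by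
  linear_combination oddRow_sub_evenRow m - evenRow_succ m

/-- Summation by parts, for any sequence `D` with the increments of `ψ(l + 1) - ψ(l + 1/2)`. -/
lemma sum_centralRatio_sq_mul_sub {D : ℕ → ℝ}
    (hD : ∀ l : ℕ, D l - D (l + 1) = 1 / ((2 * (l : ℝ) + 1) * (l + 1))) (m : ℕ) :
    ∑ l ∈ range (m + 1), centralRatio l ^ 2 * (D l - D m) = 2 * evenRow m := by
  induction m with
  | zero => simp [evenRow]
  | succ m ih =>
    rw [sum_range_succ, sub_self, mul_zero, add_zero]
    have h : ∑ l ∈ range (m + 1), centralRatio l ^ 2 * (D l - D (m + 1)) =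
        ∑ l ∈ range (m + 1), centralRatio l ^ 2 * (D l - D m) +
          (D m - D (m + 1)) * ∑ l ∈ range (m + 1), centralRatio l ^ 2 := by
      rw [mul_sum, ← sum_add_distrib]
      exact sum_congr rfl fun l _ => by ring
    rw [h, ih, hD]
    have h1 := oddRow_sub_evenRow m
    have h2 := evenRow_succ m
    have a : (2 * (m : ℝ) + 1) ≠ 0 := by positivity
    have b : ((m : ℝ) + 1) ≠ 0 := by positivity
    field_simp
    linear_combination (2 * (m : ℝ) + 1) * h2 - (2 * (m : ℝ) + 2) * h1

/-! ### The limit of the row sums -/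

/-- The partial products of Wallis' formula in terms of `centralRatio`. -/
lemma wallis_mul_centralRatio_sq (m : ℕ) :
    Real.Wallis.W m * ((2 * (m : ℝ) + 1) * centralRatio m ^ 2) = 1 := by
  induction m with
  | zero => simp [Real.Wallis.W, centralRatio_zero]
  | succ m ih =>
    rw [Real.Wallis.W_succ]
    have h : centralRatio (m + 1) = (2 * (m : ℝ) + 1) * centralRatio m / (2 * (m : ℝ) + 2) := by
      rw [← centralRatio_succ]; field_simp
    rw [h]
    refine Eq.trans ?_ ih
    push_cast
    field_simp
    ring

lemma tendsto_mul_centralRatio_sq :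
    Tendsto (fun m : ℕ => (m : ℝ) * centralRatio m ^ 2) atTop (𝓝 (1 / Real.pi)) := by
  have h1 : Tendsto (fun m : ℕ => (Real.Wallis.W m)⁻¹ * ((m : ℝ) / (2 * m + 1))) atTop
      (𝓝 ((Real.pi / 2)⁻¹ * (1 / 2))) := by
    refine (Real.Wallis.tendsto_W_nhds_pi_div_two.inv₀ (by positivity)).mul ?_
    have h2 : Tendsto (fun m : ℕ => (1 / 2 : ℝ) - 1 / 4 * (1 / ((m : ℝ) + 1 / 2))) atTop
        (𝓝 (1 / 2 - 1 / 4 * 0)) := by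
      refine tendsto_const_nhds.sub (Tendsto.const_mul _ ?_)
      exact tendsto_const_nhds.div_atTop
        (tendsto_atTop_add_const_right _ _ tendsto_natCast_atTop_atTop)
    simp only [mul_zero, sub_zero] at h2
    refine h2.congr fun m => ?_
    field_simp
    ring
  rw [show (Real.pi / 2)⁻¹ * (1 / 2) = 1 / Real.pi by field_simp] at h1
  refine h1.congr fun m => ?_
  have hW := Real.Wallis.W_pos m
  have := wallis_mul_centralRatio_sq m
  field_simp
  linear_combination -(m : ℝ) * this

lemma mul_centralRatio_sq_le (m : ℕ) : (2 * (m : ℝ) + 1) * centralRatio m ^ 2 ≤ 1 := by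
  induction m with
  | zero => simp [centralRatio_zero]
  | succ m ih =>
    refine le_trans ?_ ih
    have h : centralRatio (m + 1) = (2 * (m : ℝ) + 1) * centralRatio m / (2 * (m : ℝ) + 2) := by
      rw [← centralRatio_succ]; field_simp
    rw [h, div_pow, mul_pow, ← mul_div_assoc, div_le_iff₀ (by positivity)]
    push_cast
    nlinarith [mul_nonneg (by positivity : (0 : ℝ) ≤ 2 * m + 1) (sq_nonneg (centralRatio m))]

lemma tendsto_centralRatio_add_div (k : ℕ) :
    Tendsto (fun m : ℕ => centralRatio (m + k) / centralRatio m) atTop (𝓝 1) := by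
  induction k with
  | zero => simp [(centralRatio_pos _).ne']
  | succ k ih =>
    have h2 : Tendsto (fun m : ℕ => (1 : ℝ) - 1 / 2 * (1 / ((m : ℝ) + (k + 1)))) atTop
        (𝓝 (1 - 1 / 2 * 0)) := by
      refine tendsto_const_nhds.sub (Tendsto.const_mul _ ?_)
      exact tendsto_const_nhds.div_atTop
        (tendsto_atTop_add_const_right _ _ tendsto_natCast_atTop_atTop)
    have h3 := ih.mul h2
    simp only [mul_zero, sub_zero, mul_one] at h3
    refine h3.congr fun m => ?_
    have h4 := centralRatio_succ (m + k)
    have h5 := centralRatio_pos m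
    rw [← add_assoc]
    push_cast at h4
    have : (m : ℝ) + (k + 1) ≠ 0 := by positivity
    field_simp
    linear_combination -h4

lemma tendsto_centralRatio_mul_sub (k : ℕ) :
    Tendsto (fun m : ℕ => centralRatio m * (((m - k : ℕ) : ℝ) * centralRatio (m - k))) atTop
      (𝓝 (1 / Real.pi)) := by
  rw [← tendsto_add_atTop_iff_nat k]
  have := (tendsto_centralRatio_add_div k).mul tendsto_mul_centralRatio_sq
  rw [one_mul] at this
  refine this.congr fun m => ?_
  have h5 := centralRatio_pos m
  rw [Nat.add_sub_cancel]
  field_simp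

lemma mul_centralRatio_monotone : Monotone fun m : ℕ => (m : ℝ) * centralRatio m := by
  refine monotone_nat_of_le_succ fun m => ?_
  have h := centralRatio_succ m
  have := centralRatio_pos m
  push_cast
  nlinarith

lemma hasSum_one_div_odd_sq :
    HasSum (fun k : ℕ => 1 / (2 * (k : ℝ) + 1) ^ 2) (Real.pi ^ 2 / 8) := by
  obtain ⟨f, hf⟩ : ∃ f : ℕ → ℝ, f = fun n : ℕ => 1 / (n : ℝ) ^ 2 := ⟨_, rfl⟩
  have h : HasSum f (Real.pi ^ 2 / 6) := hf ▸ hasSum_zeta_two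
  have hs : Summable (fun k : ℕ => f (2 * k + 1)) :=
    h.summable.comp_injective (i := fun k : ℕ => 2 * k + 1) fun a b hab => by
      simp only at hab; omega
  have he : HasSum (fun k : ℕ => f (2 * k)) (1 / 4 * (Real.pi ^ 2 / 6)) := by
    have h4 : (fun k : ℕ => f (2 * k)) = fun k => 1 / 4 * f k := by
      funext k
      rw [hf]
      push_cast
      rw [mul_pow, one_div_mul_one_div]
      norm_num
    rw [h4]
    exact h.mul_left _
  have h2 := (he.even_add_odd hs.hasSum).unique h
  have h3 := hs.hasSum
  rw [show ∑' k : ℕ, f (2 * k + 1) = Real.pi ^ 2 / 8 by linarith] at h3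
  have h5 : (fun k : ℕ => f (2 * k + 1)) = fun k : ℕ => 1 / (2 * (k : ℝ) + 1) ^ 2 := by
    funext k
    rw [hf]
    push_cast
    rfl
  rwa [h5] at h3

/-- The terms of `evenRow` in reversed order. The summand vanishes for `k ≥ m` because of the
truncated subtraction, so the sum may be extended to all `k`. -/
lemma evenRow_eq_sum (m : ℕ) :
    evenRow m = ∑ k ∈ range m,
      2 * (centralRatio m * (((m - k : ℕ) : ℝ) * centralRatio (m - k))) *
        (1 / (2 * (k : ℝ) + 1) ^ 2) := by
  unfold evenRow
  rw [← sum_range_reflect, mul_sum]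
  refine sum_congr rfl fun k hk => ?_
  have hk : k < m := by simpa using hk
  obtain ⟨j, rfl⟩ : ∃ j, m = k + 1 + j := ⟨m - (k + 1), by omega⟩
  have h := centralRatio_succ j
  rw [show k + 1 + j - 1 - k = j by omega, show k + 1 + j - k = j + 1 by omega]
  push_cast
  rw [show 2 * ((k : ℝ) + 1 + j) - 2 * j - 1 = 2 * k + 1 by ring, ← h]
  ring

lemma tendsto_evenRow : Tendsto evenRow atTop (𝓝 (Real.pi / 4)) := by
  have h := tendsto_tsum_of_dominated_convergence (𝓕 := atTop)
    (f := fun (m k : ℕ) => 2 * (centralRatio m * (((m - k : ℕ) : ℝ) * centralRatio (m - k))) *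
        (1 / (2 * (k : ℝ) + 1) ^ 2))
    (g := fun k : ℕ => 2 * (1 / Real.pi) * (1 / (2 * (k : ℝ) + 1) ^ 2))
    (bound := fun k : ℕ => 1 / (2 * (k : ℝ) + 1) ^ 2)
    hasSum_one_div_odd_sq.summable
    (fun k => ((tendsto_centralRatio_mul_sub k).const_mul 2).mul_const _)
    (Eventually.of_forall fun m k => by
      have h1 : ((m - k : ℕ) : ℝ) * centralRatio (m - k) ≤ m * centralRatio m :=
        mul_centralRatio_monotone (Nat.sub_le m k)
      have h2 := mul_centralRatio_sq_le m
      have h3 := centralRatio_pos m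
      have h4 := centralRatio_pos (m - k)
      -- the coefficient is at most `2 m (centralRatio m) ^ 2`, which is less than `1`
      rw [Real.norm_of_nonneg (by positivity)]
      refine mul_le_of_le_one_left (by positivity) ?_
      nlinarith [sq_nonneg (centralRatio m), mul_le_mul_of_nonneg_left h1 h3.le])
  rw [(hasSum_one_div_odd_sq.mul_left (2 * (1 / Real.pi))).tsum_eq,
    show 2 * (1 / Real.pi) * (Real.pi ^ 2 / 8) = Real.pi / 4 by field_simp; ring] at h
  refine h.congr fun m => ?_
  rw [evenRow_eq_sum]
  refine tsum_eq_sum fun k hk => ?_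
  rw [Nat.sub_eq_zero_of_le (by simpa using hk)]
  simp

/-! ### Gamma ratios and digamma differences -/

lemma gammaRatioSq_eq (l : ℕ) : gammaRatioSq l = Real.pi * centralRatio l ^ 2 := by
  induction l with
  | zero =>
    have := Real.Gamma_one_half_eq
    simp [gammaRatioSq, centralRatio_zero] at this ⊢
    rw [this, Real.sq_sqrt Real.pi_nonneg]
  | succ l ih =>
    have h := centralRatio_succ l
    have h1 : Real.Gamma (((l + 1 : ℕ) : ℝ) + 1 / 2) =
        ((l : ℝ) + 1 / 2) * Real.Gamma ((l : ℝ) + 1 / 2) := by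
      rw [← Real.Gamma_add_one (by positivity)]
      push_cast; ring_nf
    have h2 : Real.Gamma (((l + 1 : ℕ) : ℝ) + 1) =
        ((l : ℝ) + 1) * Real.Gamma ((l : ℝ) + 1) := by
      rw [← Real.Gamma_add_one (by positivity)]
      push_cast; ring_nf
    have h3 : centralRatio (l + 1) = ((l : ℝ) + 1 / 2) / (l + 1) * centralRatio l := by
      field_simp
      linear_combination h
    unfold gammaRatioSq at ih ⊢
    rw [h1, h2, h3, mul_pow, mul_pow, mul_pow, mul_div_mul_comm, ih, div_pow]
    ring

lemma psi_eq_deriv_log_Gamma {x : ℝ} (hx : 0 < x) :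
    psi x = deriv (Real.log ∘ Real.Gamma) x := by
  have hd : DifferentiableAt ℂ Complex.Gamma (x : ℂ) := by
    refine Complex.differentiableAt_Gamma _ fun m h => ?_
    have h' : x = -(m : ℝ) := by exact_mod_cast h
    have : (0 : ℝ) ≤ m := m.cast_nonneg
    linarith
  have h1 : HasDerivAt Real.Gamma (deriv Complex.Gamma x).re x :=
    hd.hasDerivAt.real_of_complex
  have h2 : deriv Complex.Gamma (x : ℂ) = ((deriv Complex.Gamma x).re : ℂ) := by
    have h3 := h1.ofReal_comp
    have h4 := hd.hasDerivAt.comp_ofReal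
    refine h4.unique (h3.congr_of_eventuallyEq (Eventually.of_forall fun y => ?_))
    exact Complex.Gamma_ofReal y
  have h5 := (h1.log (Real.Gamma_pos_of_pos hx).ne').deriv
  rw [Function.comp_def, h5, psi, Complex.digamma_def, logDeriv_apply, h2, Complex.Gamma_ofReal,
    ← Complex.ofReal_div, Complex.ofReal_re, Complex.ofReal_re]

lemma psi_add_one {x : ℝ} (hx : 0 < x) : psi (x + 1) = psi x + x⁻¹ := by
  unfold psi
  push_cast
  rw [Complex.digamma_apply_add_one, Complex.add_re, ← Complex.ofReal_inv, Complex.ofReal_re]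
  intro m h
  have h' : x = -(m : ℝ) := by exact_mod_cast h
  have : (0 : ℝ) ≤ m := m.cast_nonneg
  linarith

/-- The digamma function is increasing, since `log Γ` is convex. -/
lemma psi_mono {x y : ℝ} (hx : 0 < x) (hxy : x ≤ y) : psi x ≤ psi y := by
  rw [psi_eq_deriv_log_Gamma hx, psi_eq_deriv_log_Gamma (hx.trans_le hxy)]
  refine Real.convexOn_log_Gamma.monotoneOn_deriv ?_ hx (hx.trans_le hxy) hxy
  intro z hz
  have hz : 0 < z := hz
  refine (Real.differentiableAt_Gamma fun m => ?_).log (Real.Gamma_pos_of_pos hz).ne'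
  have : (0 : ℝ) ≤ m := m.cast_nonneg
  linarith

/-- The difference `ψ(l + 1) - ψ(l + 1/2)`. -/
def psiGap (l : ℕ) : ℝ := psi ((l : ℝ) + 1) - psi ((l : ℝ) + 1 / 2)

lemma psiGap_nonneg (l : ℕ) : 0 ≤ psiGap l :=
  sub_nonneg.2 (psi_mono (by positivity) (by linarith))

/-- By monotonicity, `ψ(l + 1) ≤ ψ(l + 3/2) = ψ(l + 1/2) + 1 / (l + 1/2)`. -/
lemma psiGap_le (l : ℕ) : psiGap l ≤ ((l : ℝ) + 1 / 2)⁻¹ := by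
  have h : psi ((l : ℝ) + 1) ≤ psi ((l : ℝ) + 1 / 2 + 1) := psi_mono (by positivity) (by linarith)
  rw [psi_add_one (x := (l : ℝ) + 1 / 2) (by positivity)] at h
  unfold psiGap
  linarith

lemma psiGap_sub_succ (l : ℕ) :
    psiGap l - psiGap (l + 1) = 1 / ((2 * (l : ℝ) + 1) * (l + 1)) := by
  have h1 := psi_add_one (x := (l : ℝ) + 1 / 2) (by positivity)
  have h2 := psi_add_one (x := (l : ℝ) + 1) (by positivity)
  unfold psiGap
  push_cast
  rw [show (l : ℝ) + 1 + 1 / 2 = l + 1 / 2 + 1 by ring, h1, h2]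
  field_simp
  ring

/-- The boundary term of the summation by parts vanishes in the limit: `psiGap m` is `O(1/m)`, and
the means of `centralRatio l ^ 2 → 0` tend to `0`. -/
lemma tendsto_psiGap_mul_sum :
    Tendsto (fun m : ℕ => psiGap m * ∑ l ∈ range (m + 1), centralRatio l ^ 2) atTop (𝓝 0) := by
  have h0 : Tendsto (fun l : ℕ => centralRatio l ^ 2) atTop (𝓝 0) := by
    refine squeeze_zero (fun l => sq_nonneg _) (fun l => ?_)
      tendsto_one_div_add_atTop_nhds_zero_nat
    rw [le_div_iff₀ (by positivity)]
    have := mul_centralRatio_sq_le l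
    have h : (0 : ℝ) ≤ l * centralRatio l ^ 2 := by positivity
    linarith
  have h1 := (h0.cesaro.comp (tendsto_add_atTop_nat 1)).const_mul 2
  rw [mul_zero] at h1
  refine squeeze_zero (fun m => mul_nonneg (psiGap_nonneg m)
    (sum_nonneg fun l _ => sq_nonneg _)) (fun m => ?_) h1
  simp only [Function.comp_apply]
  rw [← mul_assoc]
  refine mul_le_mul_of_nonneg_right ((psiGap_le m).trans ?_) (sum_nonneg fun l _ => sq_nonneg _)
  rw [← div_eq_mul_inv, ← one_div, div_le_div_iff₀ (by positivity) (by positivity)]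
  push_cast
  linarith

/-- The partial sums are `π (2 evenRow m + psiGap m * ∑ l ≤ m, centralRatio l ^ 2)`. -/
lemma hasSum_gammaRatioSq_mul_psiGap :
    HasSum (fun l : ℕ => gammaRatioSq l * psiGap l) (Real.pi ^ 2 / 2) := by
  rw [hasSum_iff_tendsto_nat_of_nonneg
    (fun l => mul_nonneg (by rw [gammaRatioSq_eq]; positivity) (psiGap_nonneg l)),
    ← tendsto_add_atTop_iff_nat 1]
  have h := ((tendsto_evenRow.const_mul 2).add tendsto_psiGap_mul_sum).const_mul Real.pi
  rw [show Real.pi * (2 * (Real.pi / 4) + 0) = Real.pi ^ 2 / 2 by ring] at h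
  refine h.congr fun m => ?_
  rw [← sum_centralRatio_sq_mul_sub psiGap_sub_succ, mul_sum, ← sum_add_distrib, mul_sum]
  refine sum_congr rfl fun l _ => ?_
  rw [gammaRatioSq_eq]
  ring

/-- The bracket sum of the closed formula in terms of `evenRow`. -/
lemma sum_gammaRatioSq_mul_psi (m : ℕ) :
    ∑ l ∈ range (m + 1), gammaRatioSq l * (psi ((m : ℝ) + 1 / 2) - psi ((m : ℝ) + 1)
      - psi ((l : ℝ) + 1 / 2) + psi ((l : ℝ) + 1)) = 2 * Real.pi * evenRow m := by
  rw [show 2 * Real.pi * evenRow m = Real.pi * (2 * evenRow m) by ring,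
    ← sum_centralRatio_sq_mul_sub psiGap_sub_succ, mul_sum]
  refine sum_congr rfl fun l _ => ?_
  rw [gammaRatioSq_eq, psiGap, psiGap]
  ring

/-- Both closed forms follow from the value of the variance in terms of `evenRow`: the tail of the
series is `π² / 2` minus its partial sum, and the constant `π² / 2` produces the term `n / 4`. -/
lemma closed_formulas_of_variance (V : ℝ) (n m : ℕ)
    (hV : V = (n : ℝ) / 4 - (n : ℝ) / Real.pi * evenRow m) :
    V = (n : ℝ) / 4 - (n : ℝ) / (2 * Real.pi ^ 2) *
        ∑ l ∈ Finset.range (m + 1), gammaRatioSq l *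
          (psi ((m : ℝ) + 1 / 2) - psi ((m : ℝ) + 1)
            - psi ((l : ℝ) + 1 / 2) + psi ((l : ℝ) + 1)) ∧
      ∃ T : ℝ,
        HasSum (fun i : ℕ => gammaRatioSq (m + 1 + i) *
          (psi (((m + 1 + i : ℕ) : ℝ) + 1) - psi (((m + 1 + i : ℕ) : ℝ) + 1 / 2))) T ∧
        V = (n : ℝ) / (2 * Real.pi ^ 2) *
            ((psi ((m : ℝ) + 1) - psi ((m : ℝ) + 1 / 2)) *
              ∑ l ∈ Finset.range (m + 1), gammaRatioSq l + T) := by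
  have hpi := Real.pi_pos
  refine ⟨?_, Real.pi ^ 2 / 2 - ∑ l ∈ range (m + 1), gammaRatioSq l * psiGap l, ?_, ?_⟩
  · rw [sum_gammaRatioSq_mul_psi, hV]
    field_simp
  · have h := (hasSum_nat_add_iff' (m + 1)).2 hasSum_gammaRatioSq_mul_psiGap
    simpa only [add_comm _ (m + 1), psiGap] using h
  · have h : 2 * Real.pi * evenRow m = ∑ l ∈ range (m + 1), gammaRatioSq l * psiGap l -
        psiGap m * ∑ l ∈ range (m + 1), gammaRatioSq l := by
      rw [← sum_gammaRatioSq_mul_psi, mul_sum, ← sum_sub_distrib]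
      refine sum_congr rfl fun l _ => ?_
      rw [psiGap, psiGap]
      ring
    rw [hV, ← psiGap, mul_add, mul_sub]
    have h' : psiGap m * ∑ l ∈ range (m + 1), gammaRatioSq l =
      ∑ l ∈ range (m + 1), gammaRatioSq l * psiGap l - 2 * Real.pi * evenRow m := by linarith
    rw [h']
    field_simp
    ring

/-! ### Hermite polynomials on the half-line -/

/-- The monic Hermite polynomials, orthogonal for the weight `exp (-x ^ 2)`. (Mathlib's
`Polynomial.hermite` is orthogonal for `exp (-x ^ 2 / 2)`.) -/
def hermiteMonic : ℕ → ℝ[X]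
  | 0 => 1
  | n + 1 => X * hermiteMonic n - C (1 / 2) * derivative (hermiteMonic n)

lemma hermiteMonic_succ (n : ℕ) :
    hermiteMonic (n + 1) = X * hermiteMonic n - C (1 / 2) * derivative (hermiteMonic n) := rfl

lemma derivative_hermiteMonic_succ (n : ℕ) :
    derivative (hermiteMonic (n + 1)) = C ((n : ℝ) + 1) * hermiteMonic n := by
  induction n with
  | zero => simp [hermiteMonic]
  | succ n ih =>
    rw [hermiteMonic_succ (n + 1)]
    simp only [derivative_sub, derivative_mul, derivative_X, derivative_C, ih, zero_mul, zero_add,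
      one_mul]
    rw [hermiteMonic_succ n]
    push_cast
    simp only [map_add, map_one]
    ring

/-- The Hermite differential equation `h'' - 2 x h' + 2 n h = 0`. -/
lemma hermiteMonic_ode (n : ℕ) :
    derivative (derivative (hermiteMonic n)) =
      2 * X * derivative (hermiteMonic n) - C (2 * (n : ℝ)) * hermiteMonic n := by
  cases n with
  | zero => simp [hermiteMonic]
  | succ n =>
    have h2 : (2 : ℝ[X]) * C (1 / 2) = 1 := by
      rw [← C_ofNat, ← C_mul]
      norm_num
    rw [derivative_hermiteMonic_succ, derivative_C_mul, hermiteMonic_succ]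
    push_cast
    simp only [map_add, map_one, map_mul, C_ofNat]
    linear_combination -(C (n : ℝ) + 1) * derivative (hermiteMonic n) * h2

lemma natDegree_hermiteMonic_and_monic (n : ℕ) :
    (hermiteMonic n).natDegree = n ∧ (hermiteMonic n).Monic := by
  induction n with
  | zero => simp [hermiteMonic]
  | succ n ih =>
    have h1 : (X * hermiteMonic n).Monic := monic_X.mul ih.2
    have h2 : (X * hermiteMonic n).degree = ((n + 1 : ℕ) : WithBot ℕ) := by
      rw [degree_eq_natDegree h1.ne_zero, monic_X.natDegree_mul ih.2, natDegree_X, ih.1, add_comm]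
    have h3 : (C (1 / 2 : ℝ) * derivative (hermiteMonic n)).degree <
        (X * hermiteMonic n).degree := by
      rw [h2, degree_C_mul (by norm_num)]
      refine degree_derivative_le.trans_lt ?_
      rw [degree_eq_natDegree ih.2.ne_zero, ih.1]
      exact_mod_cast Nat.lt_succ_self n
    refine ⟨?_, h1.sub_of_left h3⟩
    exact natDegree_eq_of_degree_eq_some
      (by rw [hermiteMonic_succ, degree_sub_eq_left_of_degree_lt h3, h2])

lemma hermiteMonic_eval_zero_succ_succ (n : ℕ) :
    (hermiteMonic (n + 2)).eval 0 = -(((n : ℝ) + 1) / 2) * (hermiteMonic n).eval 0 := by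
  rw [hermiteMonic_succ, derivative_hermiteMonic_succ]
  simp
  ring

lemma hermiteMonic_odd_eval_zero (s : ℕ) : (hermiteMonic (2 * s + 1)).eval 0 = 0 := by
  induction s with
  | zero => simp [hermiteMonic]
  | succ s ih =>
    rw [show 2 * (s + 1) + 1 = 2 * s + 1 + 2 by ring, hermiteMonic_eval_zero_succ_succ, ih, mul_zero]

lemma hasDerivAt_eval_mul_gaussian (q : ℝ[X]) (x : ℝ) :
    HasDerivAt (fun x => q.eval x * Real.exp (-x ^ 2))
      ((derivative q - 2 * X * q).eval x * Real.exp (-x ^ 2)) x := by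
  have h1 : HasDerivAt (fun x : ℝ => Real.exp (-x ^ 2)) (Real.exp (-x ^ 2) * (-(2 * x))) x := by
    have := ((hasDerivAt_pow 2 x).neg).exp
    simpa using this
  refine ((q.hasDerivAt x).mul h1).congr_deriv ?_
  simp
  ring

lemma integrable_eval_mul_gaussian (q : ℝ[X]) :
    Integrable fun x : ℝ => q.eval x * Real.exp (-x ^ 2) := by
  induction q using Polynomial.induction_on' with
  | add p q hp hq =>
    simp only [eval_add, add_mul]
    exact hp.add hq
  | monomial n a =>
    have h := (integrable_rpow_mul_exp_neg_mul_sq (b := 1) one_pos (s := (n : ℝ))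
      (by linarith [(n.cast_nonneg : (0 : ℝ) ≤ n)])).const_mul a
    refine h.congr (Eventually.of_forall fun x => ?_)
    simp [mul_assoc]

lemma tendsto_eval_mul_gaussian (q : ℝ[X]) :
    Tendsto (fun x : ℝ => q.eval x * Real.exp (-x ^ 2)) atTop (𝓝 0) :=
  tendsto_zero_of_hasDerivAt_of_integrableOn_Ioi (a := 0)
    (fun x _ => hasDerivAt_eval_mul_gaussian q x)
    (integrable_eval_mul_gaussian _).integrableOn (integrable_eval_mul_gaussian _).integrableOn

/-- Integration of a polynomial over `S` against `exp (-x ^ 2)`, as a linear form. -/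
def gaussInt (S : Set ℝ) : ℝ[X] →ₗ[ℝ] ℝ where
  toFun q := ∫ x in S, q.eval x * Real.exp (-x ^ 2)
  map_add' p q := by
    simp only [eval_add, add_mul]
    exact integral_add (integrable_eval_mul_gaussian p).integrableOn
      (integrable_eval_mul_gaussian q).integrableOn
  map_smul' c q := by
    simp only [eval_smul, smul_eq_mul, mul_assoc, RingHom.id_apply]
    exact integral_const_mul _ _

lemma gaussInt_apply (S : Set ℝ) (q : ℝ[X]) :
    gaussInt S q = ∫ x in S, q.eval x * Real.exp (-x ^ 2) := rfl

lemma gaussInt_C_mul (S : Set ℝ) (c : ℝ) (q : ℝ[X]) : gaussInt S (C c * q) = c * gaussInt S q := by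
  rw [← smul_eq_C_mul, map_smul, smul_eq_mul]

lemma gaussInt_univ_derivative (q : ℝ[X]) :
    gaussInt Set.univ (derivative q - 2 * X * q) = 0 := by
  rw [gaussInt_apply, setIntegral_univ]
  exact integral_eq_zero_of_hasDerivAt_of_integrable (hasDerivAt_eval_mul_gaussian q)
    (integrable_eval_mul_gaussian _) (integrable_eval_mul_gaussian _)

lemma gaussInt_Ioi_derivative (q : ℝ[X]) :
    gaussInt (Set.Ioi 0) (derivative q - 2 * X * q) = -q.eval 0 := by
  rw [gaussInt_apply, integral_Ioi_of_hasDerivAt_of_tendsto'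
    (fun x _ => hasDerivAt_eval_mul_gaussian q x)
    (integrable_eval_mul_gaussian _).integrableOn (tendsto_eval_mul_gaussian q)]
  simp

/-- The Wronskian of two Hermite polynomials, times the weight, is a primitive of a multiple of
their product. -/
lemma wronskian_hermiteMonic (j k : ℕ) :
    derivative (derivative (hermiteMonic j) * hermiteMonic k -
        hermiteMonic j * derivative (hermiteMonic k)) -
      2 * X * (derivative (hermiteMonic j) * hermiteMonic k -
        hermiteMonic j * derivative (hermiteMonic k)) =
      C (2 * (k : ℝ) - 2 * j) * (hermiteMonic j * hermiteMonic k) := by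
  simp only [derivative_mul, hermiteMonic_ode, map_sub]
  ring

lemma gaussInt_univ_hermiteMonic_of_ne {j k : ℕ} (h : j ≠ k) :
    gaussInt Set.univ (hermiteMonic j * hermiteMonic k) = 0 := by
  have h1 := gaussInt_univ_derivative (derivative (hermiteMonic j) * hermiteMonic k -
        hermiteMonic j * derivative (hermiteMonic k))
  rw [wronskian_hermiteMonic, gaussInt_C_mul] at h1
  refine (mul_eq_zero.1 h1).resolve_left ?_
  have : (j : ℝ) ≠ k := by exact_mod_cast h
  intro h2
  exact this (by linarith)

lemma gaussInt_Ioi_hermiteMonic (j k : ℕ) :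
    (2 * (k : ℝ) - 2 * j) * gaussInt (Set.Ioi 0) (hermiteMonic j * hermiteMonic k) =
      (hermiteMonic j).eval 0 * (derivative (hermiteMonic k)).eval 0 -
        (derivative (hermiteMonic j)).eval 0 * (hermiteMonic k).eval 0 := by
  rw [← gaussInt_C_mul, ← wronskian_hermiteMonic, gaussInt_Ioi_derivative]
  simp

/-- Integrating this identity relates the squared norms of consecutive Hermite polynomials, over the
line and, the product being odd, over the half-line as well. -/
lemma hermiteMonic_mul_succ_derivative (n : ℕ) :
    derivative (hermiteMonic n * hermiteMonic (n + 1)) -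
        2 * X * (hermiteMonic n * hermiteMonic (n + 1)) =
      C ((n : ℝ) + 1) * (hermiteMonic n * hermiteMonic n) -
        C 2 * (hermiteMonic (n + 1) * hermiteMonic (n + 1)) := by
  have h2 : (2 : ℝ[X]) * C (1 / 2) = 1 := by
    rw [← C_ofNat, ← C_mul]
    norm_num
  rw [derivative_mul, derivative_hermiteMonic_succ, C_ofNat]
  linear_combination 2 * hermiteMonic (n + 1) * hermiteMonic_succ n -
    hermiteMonic (n + 1) * derivative (hermiteMonic n) * h2

lemma hermiteMonic_mul_succ_eval_zero (n : ℕ) :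
    (hermiteMonic n * hermiteMonic (n + 1)).eval 0 = 0 := by
  rw [eval_mul]
  rcases Nat.even_or_odd' n with ⟨s, rfl | rfl⟩
  · rw [hermiteMonic_odd_eval_zero, mul_zero]
  · rw [hermiteMonic_odd_eval_zero, zero_mul]

/-- The squared norm of a monic Hermite polynomial. -/
def hermiteNormSq (n : ℕ) : ℝ := gaussInt Set.univ (hermiteMonic n * hermiteMonic n)

lemma hermiteNormSq_zero : hermiteNormSq 0 = √Real.pi := by
  have := integral_gaussian 1
  simp [hermiteNormSq, gaussInt_apply, hermiteMonic] at this ⊢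
  exact this

lemma hermiteNormSq_succ (n : ℕ) :
    hermiteNormSq (n + 1) = ((n : ℝ) + 1) / 2 * hermiteNormSq n := by
  have h := gaussInt_univ_derivative (hermiteMonic n * hermiteMonic (n + 1))
  rw [hermiteMonic_mul_succ_derivative, map_sub, gaussInt_C_mul, gaussInt_C_mul] at h
  unfold hermiteNormSq
  linarith

lemma hermiteNormSq_pos (n : ℕ) : 0 < hermiteNormSq n := by
  induction n with
  | zero => rw [hermiteNormSq_zero]; positivity
  | succ n ih => rw [hermiteNormSq_succ]; positivity

/-- Each Hermite function has half of its mass on the half-line. -/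
lemma gaussInt_Ioi_hermiteMonic_self (n : ℕ) :
    gaussInt (Set.Ioi 0) (hermiteMonic n * hermiteMonic n) = hermiteNormSq n / 2 := by
  induction n with
  | zero =>
    have := integral_gaussian_Ioi 1
    rw [hermiteNormSq_zero]
    simp [gaussInt_apply, hermiteMonic] at this ⊢
    exact this
  | succ n ih =>
    have h := gaussInt_Ioi_derivative (hermiteMonic n * hermiteMonic (n + 1))
    rw [hermiteMonic_mul_succ_derivative, map_sub, gaussInt_C_mul, gaussInt_C_mul,
      hermiteMonic_mul_succ_eval_zero, ih] at h
    rw [hermiteNormSq_succ]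
    linarith

/-- The inner product over the positive half-line of two normalised Hermite functions. -/
def overlap (j k : ℕ) : ℝ :=
  gaussInt (Set.Ioi 0) (hermiteMonic j * hermiteMonic k) / (√(hermiteNormSq j) * √(hermiteNormSq k))

lemma overlap_comm (j k : ℕ) : overlap j k = overlap k j := by
  unfold overlap
  rw [mul_comm (hermiteMonic j), mul_comm (√_)]

lemma overlap_self (n : ℕ) : overlap n n = 1 / 2 := by
  have h := hermiteNormSq_pos n
  rw [overlap, gaussInt_Ioi_hermiteMonic_self, Real.mul_self_sqrt h.le]
  field_simp

lemma overlap_sq (j k : ℕ) : overlap j k ^ 2 =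
    gaussInt (Set.Ioi 0) (hermiteMonic j * hermiteMonic k) ^ 2 /
      (hermiteNormSq j * hermiteNormSq k) := by
  rw [overlap, div_pow, mul_pow, Real.sq_sqrt (hermiteNormSq_pos j).le,
    Real.sq_sqrt (hermiteNormSq_pos k).le]

lemma derivative_hermiteMonic_even_eval_zero (r : ℕ) :
    (derivative (hermiteMonic (2 * r))).eval 0 = 0 := by
  cases r with
  | zero => simp [hermiteMonic]
  | succ r =>
    rw [show 2 * (r + 1) = 2 * r + 1 + 1 by ring, derivative_hermiteMonic_succ, eval_mul,
      hermiteMonic_odd_eval_zero, mul_zero]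

lemma overlap_even_even {r s : ℕ} (h : r ≠ s) : overlap (2 * r) (2 * s) = 0 := by
  have h1 := gaussInt_Ioi_hermiteMonic (2 * r) (2 * s)
  rw [derivative_hermiteMonic_even_eval_zero, derivative_hermiteMonic_even_eval_zero, mul_zero,
    zero_mul, sub_zero] at h1
  have h2 : (r : ℝ) ≠ s := by exact_mod_cast h
  rw [overlap, (mul_eq_zero.1 h1).resolve_left, zero_div]
  push_cast
  intro h3
  exact h2 (by linarith)

lemma overlap_odd_odd {r s : ℕ} (h : r ≠ s) : overlap (2 * r + 1) (2 * s + 1) = 0 := by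
  have h1 := gaussInt_Ioi_hermiteMonic (2 * r + 1) (2 * s + 1)
  rw [hermiteMonic_odd_eval_zero, hermiteMonic_odd_eval_zero, mul_zero,
    zero_mul, sub_zero] at h1
  have h2 : (r : ℝ) ≠ s := by exact_mod_cast h
  rw [overlap, (mul_eq_zero.1 h1).resolve_left, zero_div]
  push_cast
  intro h3
  exact h2 (by linarith)

lemma hermiteMonic_even_eval_zero_sq (r : ℕ) :
    (hermiteMonic (2 * r)).eval 0 ^ 2 = hermiteNormSq (2 * r) * (centralRatio r / √Real.pi) := by
  induction r with
  | zero =>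
    rw [mul_zero, hermiteNormSq_zero, centralRatio_zero]
    have : √Real.pi ≠ 0 := by positivity
    simp [hermiteMonic, mul_inv_cancel₀ this]
  | succ r ih =>
    have h := centralRatio_succ r
    rw [show 2 * (r + 1) = 2 * r + 2 by ring, hermiteMonic_eval_zero_succ_succ, hermiteNormSq_succ,
      hermiteNormSq_succ, mul_pow, ih]
    push_cast
    linear_combination -((2 * (r : ℝ) + 1) / 4 * hermiteNormSq (2 * r) / √Real.pi) * h

lemma overlap_even_odd_sq (r s : ℕ) : overlap (2 * r) (2 * s + 1) ^ 2 =
    (2 * (s : ℝ) + 1) * centralRatio r * centralRatio s /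
      (2 * Real.pi * (2 * (s : ℝ) + 1 - 2 * r) ^ 2) := by
  have h1 := gaussInt_Ioi_hermiteMonic (2 * r) (2 * s + 1)
  rw [hermiteMonic_odd_eval_zero, mul_zero, sub_zero, derivative_hermiteMonic_succ, eval_mul,
    eval_C] at h1
  have h2 := congrArg (· ^ 2) h1
  simp only [mul_pow, hermiteMonic_even_eval_zero_sq] at h2
  have hr := hermiteNormSq_pos (2 * r)
  have hs := hermiteNormSq_pos (2 * s)
  have hpi := Real.pi_pos
  have hd : (2 * (s : ℝ) + 1 - 2 * r) ≠ 0 := by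
    intro h
    have : 2 * s + 1 = 2 * r := by exact_mod_cast sub_eq_zero.1 h
    omega
  have hq := Real.sq_sqrt hpi.le
  rw [overlap_sq, hermiteNormSq_succ]
  push_cast at h2 ⊢
  have h4 : gaussInt (Set.Ioi 0) (hermiteMonic (2 * r) * hermiteMonic (2 * s + 1)) ^ 2 =
      hermiteNormSq (2 * r) * hermiteNormSq (2 * s) * (2 * (s : ℝ) + 1) ^ 2 * centralRatio r *
        centralRatio s / (4 * Real.pi * (2 * (s : ℝ) + 1 - 2 * r) ^ 2) := by
    rw [eq_div_iff (by positivity)]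
    have h5 : (centralRatio r / √Real.pi) * (centralRatio s / √Real.pi) * Real.pi =
        centralRatio r * centralRatio s := by
      rw [div_mul_div_comm, Real.mul_self_sqrt hpi.le]
      field_simp
    linear_combination Real.pi * h2 +
      hermiteNormSq (2 * r) * hermiteNormSq (2 * s) * (2 * (s : ℝ) + 1) ^ 2 * h5
  rw [h4]
  field_simp
  ring

lemma sum_range_two_mul (f : ℕ → ℝ) (m : ℕ) :
    ∑ j ∈ range (2 * m), f j = ∑ s ∈ range m, f (2 * s) + ∑ s ∈ range m, f (2 * s + 1) := by
  induction m with
  | zero => simp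
  | succ m ih =>
    rw [show 2 * (m + 1) = 2 * m + 1 + 1 by ring, sum_range_succ, sum_range_succ, ih,
      sum_range_succ, sum_range_succ]
    ring

lemma sum_overlap_even (m : ℕ) :
    ∑ j ∈ range (2 * m), overlap j (2 * m) ^ 2 = evenRow m / (2 * Real.pi) := by
  rw [sum_range_two_mul, sum_eq_zero, zero_add, evenRow, mul_sum, sum_div]
  · refine sum_congr rfl fun s _ => ?_
    rw [overlap_comm, overlap_even_odd_sq]
    rw [show (2 * (s : ℝ) + 1 - 2 * m) ^ 2 = (2 * (m : ℝ) - 2 * s - 1) ^ 2 by ring,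
      mul_div_assoc', div_div]
    congr 1 <;> ring
  · intro r hr
    have : r ≠ m := by simp at hr; omega
    rw [overlap_even_even this]
    simp

lemma sum_overlap_odd (m : ℕ) :
    ∑ j ∈ range (2 * m + 1), overlap j (2 * m + 1) ^ 2 = oddRow m / (2 * Real.pi) := by
  rw [sum_range_succ, sum_range_two_mul, add_assoc,
    sum_eq_zero (f := fun s => overlap (2 * s + 1) (2 * m + 1) ^ 2), zero_add,
    ← sum_range_succ (fun r => overlap (2 * r) (2 * m + 1) ^ 2), oddRow, mul_sum, sum_div]
  · refine sum_congr rfl fun r _ => ?_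
    rw [overlap_even_odd_sq, mul_div_assoc', div_div]
    congr 1 <;> ring
  · intro r hr
    have : r ≠ m := by simp at hr; omega
    rw [overlap_odd_odd this]
    simp

/-- A sequence that starts at `0` and has the increments of `tr A - tr A²`, for `A` the overlap
matrices of growing size, has a closed form in `evenRow`. -/
lemma eq_evenRow_of_increment {V : ℕ → ℝ} (h0 : V 0 = 0)
    (h : ∀ n, V (n + 1) = V n + 1 / 4 - 2 * ∑ j ∈ range n, overlap j n ^ 2) (m : ℕ) :
    V (2 * m) = ((2 * m : ℕ) : ℝ) / 4 - ((2 * m : ℕ) : ℝ) / Real.pi * evenRow m ∧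
    V (2 * m + 1) =
      ((2 * m + 1 : ℕ) : ℝ) / 4 - ((2 * m + 1 : ℕ) : ℝ) / Real.pi * evenRow m := by
  have hpi := Real.pi_pos
  have key : ∀ m : ℕ, V (2 * m) = ((2 * m : ℕ) : ℝ) / 4 - ((2 * m : ℕ) : ℝ) / Real.pi * evenRow m →
      V (2 * m + 1) =
        ((2 * m + 1 : ℕ) : ℝ) / 4 - ((2 * m + 1 : ℕ) : ℝ) / Real.pi * evenRow m := by
    intro m hm
    rw [h, sum_overlap_even, hm]
    push_cast
    field_simp
    ring
  suffices V (2 * m) = ((2 * m : ℕ) : ℝ) / 4 - ((2 * m : ℕ) : ℝ) / Real.pi * evenRow m from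
    ⟨this, key m this⟩
  induction m with
  | zero => simp [h0]
  | succ m ih =>
    have hstep := evenRow_step m
    rw [show 2 * (m + 1) = 2 * m + 1 + 1 by ring, h, sum_overlap_odd, key m ih]
    push_cast
    field_simp
    linear_combination (4 : ℝ) * hstep

/-! ### The generating function and the variance of the index -/

section Andreief

variable {n : ℕ} (φ : Fin n → ℝ → ℝ) (f : ℝ → ℝ)

lemma det_sq_mul_prod_expand (x : Fin n → ℝ) :
    (Matrix.of fun i j => φ j (x i)).det ^ 2 * ∏ i, f (x i) =
      ∑ σ : Equiv.Perm (Fin n), ∑ τ : Equiv.Perm (Fin n),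
        ((Equiv.Perm.sign σ : ℤ) : ℝ) * ((Equiv.Perm.sign τ : ℤ) : ℝ) *
          ∏ i, (f (x i) * φ (σ i) (x i) * φ (τ i) (x i)) := by
  rw [← det_transpose, det_apply', sq, sum_mul_sum, sum_mul]
  refine sum_congr rfl fun σ _ => ?_
  rw [sum_mul]
  refine sum_congr rfl fun τ _ => ?_
  simp only [prod_mul_distrib, transpose_apply, of_apply]
  ring

lemma integrable_det_sq_mul_prod
    (hφ : ∀ j k, Integrable fun x => f x * φ j x * φ k x) :
    Integrable fun x : Fin n → ℝ =>
      (Matrix.of fun i j => φ j (x i)).det ^ 2 * ∏ i, f (x i) := by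
  simp only [det_sq_mul_prod_expand]
  refine integrable_finsetSum _ fun σ _ => integrable_finsetSum _ fun τ _ => ?_
  exact (Integrable.fintype_prod
    (f := fun (i : Fin n) x => f x * φ (σ i) x * φ (τ i) x) fun i => hφ _ _).const_mul _

/-- The **Andréief identity**, for one family of functions. -/
lemma integral_det_sq_mul_prod
    (hφ : ∀ j k, Integrable fun x => f x * φ j x * φ k x) :
    ∫ x : Fin n → ℝ, (Matrix.of fun i j => φ j (x i)).det ^ 2 * ∏ i, f (x i) =
      (n.factorial : ℝ) * (Matrix.of fun j k => ∫ x, f x * φ j x * φ k x).det := by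
  have hint : ∀ σ τ : Equiv.Perm (Fin n), Integrable fun x : Fin n → ℝ =>
      ((Equiv.Perm.sign σ : ℤ) : ℝ) * ((Equiv.Perm.sign τ : ℤ) : ℝ) *
          ∏ i, (f (x i) * φ (σ i) (x i) * φ (τ i) (x i)) := fun σ τ =>
    (Integrable.fintype_prod
      (f := fun (i : Fin n) x => f x * φ (σ i) x * φ (τ i) x) fun i => hφ _ _).const_mul _
  simp only [det_sq_mul_prod_expand]
  rw [integral_finsetSum _ fun σ _ => integrable_finsetSum _ fun τ _ => hint σ τ]
  obtain ⟨G, hG⟩ : ∃ G : Matrix (Fin n) (Fin n) ℝ,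
    G = Matrix.of fun j k => ∫ x, f x * φ j x * φ k x := ⟨_, rfl⟩
  -- every row permutation `σ` contributes one copy of the determinant
  have hσ : ∀ σ : Equiv.Perm (Fin n), (∫ x : Fin n → ℝ, ∑ τ : Equiv.Perm (Fin n),
      ((Equiv.Perm.sign σ : ℤ) : ℝ) * ((Equiv.Perm.sign τ : ℤ) : ℝ) *
          ∏ i, (f (x i) * φ (σ i) (x i) * φ (τ i) (x i))) = G.det := by
    intro σ
    rw [integral_finsetSum _ fun τ _ => hint σ τ]
    have h1 : ∀ τ : Equiv.Perm (Fin n), (∫ x : Fin n → ℝ,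
        ((Equiv.Perm.sign σ : ℤ) : ℝ) * ((Equiv.Perm.sign τ : ℤ) : ℝ) *
          ∏ i, (f (x i) * φ (σ i) (x i) * φ (τ i) (x i))) =
        ((Equiv.Perm.sign σ : ℤ) : ℝ) * (((Equiv.Perm.sign τ : ℤ) : ℝ) *
          ∏ i, (Gᵀ.submatrix id σ) (τ i) i) := by
      intro τ
      rw [integral_const_mul, integral_fintype_prod_volume_eq_prod
        (f := fun (i : Fin n) x => f x * φ (σ i) x * φ (τ i) x), mul_assoc, hG]
      rfl
    simp only [h1]
    rw [← mul_sum, ← det_apply', det_permute', det_transpose, ← mul_assoc]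
    have h2 : ((Equiv.Perm.sign σ : ℤ) : ℝ) * ((Equiv.Perm.sign σ : ℤ) : ℝ) = 1 := by
      rw [← Int.cast_mul, Int.units_coe_mul_self, Int.cast_one]
    rw [h2, one_mul]
  rw [sum_congr rfl fun σ _ => hσ σ, sum_const, card_univ, Fintype.card_perm, Fintype.card_fin,
    nsmul_eq_mul, hG]

end Andreief

/-- The joint density as a squared determinant of Hermite polynomials. -/
lemma weight_eq_det (n : ℕ) (x : Fin n → ℝ) :
    weight n x = (Matrix.of fun i j : Fin n => (hermiteMonic j).eval (x i)).det ^ 2 *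
      ∏ i, Real.exp (-x i ^ 2) := by
  rw [← det_eval_matrixOfPolynomials_eq_det_vandermonde x (fun j => hermiteMonic j)
    (fun j => (natDegree_hermiteMonic_and_monic j).1)
    (fun j => (natDegree_hermiteMonic_and_monic j).2), det_vandermonde, weight,
    ← Real.exp_sum, sum_neg_distrib, mul_comm, ← prod_pow]
  congr 1
  refine prod_congr rfl fun i _ => ?_
  rw [← prod_pow]
  exact prod_congr rfl fun j _ => by ring

lemma index_eq_card {n : ℕ} (x : Fin n → ℝ) :
    index x = (univ.filter fun j => 0 < x j).card := by
  rw [index, Set.ncard_eq_toFinset_card']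
  congr 1
  ext j
  simp

lemma index_le {n : ℕ} (x : Fin n → ℝ) : index x ≤ n := by
  rw [index_eq_card]
  exact (card_filter_le _ _).trans (by simp)

lemma measurable_index (n : ℕ) : Measurable (index : (Fin n → ℝ) → ℕ) := by
  have h : (index : (Fin n → ℝ) → ℕ) = fun x => ∑ j, if 0 < x j then 1 else 0 := by
    funext x
    rw [index_eq_card, card_filter]
  rw [h]
  refine Finset.measurable_sum _ fun j _ => ?_
  exact Measurable.ite (measurableSet_lt measurable_const (measurable_pi_apply j))
    measurable_const measurable_const

/-- The Gaussian weight, multiplied by `s` on the positive half-line. -/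
def tiltedGaussian (s x : ℝ) : ℝ := Real.exp (-x ^ 2) * if 0 < x then s else 1

/-- Tilting every coordinate inserts the factor `s ^ index x`. -/
lemma prod_tiltedGaussian {n : ℕ} (s : ℝ) (x : Fin n → ℝ) :
    ∏ i, tiltedGaussian s (x i) = (∏ i, Real.exp (-x i ^ 2)) * s ^ index x := by
  unfold tiltedGaussian
  rw [prod_mul_distrib, index_eq_card, prod_ite]
  simp

lemma tiltedGaussian_mul_eval (s : ℝ) (p q : ℝ[X]) :
    (fun x => tiltedGaussian s x * p.eval x * q.eval x) = fun x =>
      (p * q).eval x * Real.exp (-x ^ 2) + (s - 1) *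
        (Set.Ioi (0 : ℝ)).indicator (fun x => (p * q).eval x * Real.exp (-x ^ 2)) x := by
  funext x
  by_cases hx : 0 < x
  · rw [Set.indicator_of_mem (show x ∈ Set.Ioi 0 from hx)]
    simp only [tiltedGaussian, hx, if_true, eval_mul]
    ring
  · rw [Set.indicator_of_notMem (show x ∉ Set.Ioi 0 from hx)]
    simp only [tiltedGaussian, hx, if_false, eval_mul]
    ring

lemma integrable_tiltedGaussian_mul_eval (s : ℝ) (p q : ℝ[X]) :
    Integrable fun x => tiltedGaussian s x * p.eval x * q.eval x := by
  rw [tiltedGaussian_mul_eval]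
  exact (integrable_eval_mul_gaussian _).add
    (((integrable_eval_mul_gaussian _).indicator measurableSet_Ioi).const_mul _)

lemma integral_tiltedGaussian_mul_eval (s : ℝ) (p q : ℝ[X]) :
    ∫ x, tiltedGaussian s x * p.eval x * q.eval x =
      gaussInt Set.univ (p * q) + (s - 1) * gaussInt (Set.Ioi 0) (p * q) := by
  rw [tiltedGaussian_mul_eval, integral_add (integrable_eval_mul_gaussian _)
    (((integrable_eval_mul_gaussian _).indicator measurableSet_Ioi).const_mul _),
    integral_const_mul, integral_indicator measurableSet_Ioi, gaussInt_apply, gaussInt_apply,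
    setIntegral_univ]

/-- The matrix of the half-line overlaps of the first `n` Hermite functions. -/
def overlapMatrix (n : ℕ) : Matrix (Fin n) (Fin n) ℝ := Matrix.of fun j k => overlap j k

lemma weight_mul_pow_index (n : ℕ) (s : ℝ) (x : Fin n → ℝ) : weight n x * s ^ index x =
    (Matrix.of fun i j : Fin n => (hermiteMonic j).eval (x i)).det ^ 2 *
      ∏ i, tiltedGaussian s (x i) := by
  rw [weight_eq_det, prod_tiltedGaussian, mul_assoc]

lemma integrable_weight (n : ℕ) : Integrable (weight n) := by
  have h := integrable_det_sq_mul_prod (n := n) (fun j x => (hermiteMonic j).eval x)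
    (tiltedGaussian 1) fun j k => integrable_tiltedGaussian_mul_eval 1 _ _
  simp only [← weight_mul_pow_index, one_pow, mul_one] at h
  exact h

lemma integral_weight_mul_pow_index (n : ℕ) (s : ℝ) :
    ∫ x : Fin n → ℝ, weight n x * s ^ index x =
      (n.factorial : ℝ) * (∏ j : Fin n, hermiteNormSq j) *
        (1 + (s - 1) • overlapMatrix n).det := by
  simp only [weight_mul_pow_index]
  rw [integral_det_sq_mul_prod (n := n) (fun j x => (hermiteMonic j).eval x)
    (tiltedGaussian s) fun j k => integrable_tiltedGaussian_mul_eval s _ _, mul_assoc]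
  congr 1
  -- the Gram matrix is `1 + (s - 1) A`, scaled by the norms of the Hermite polynomials
  have h : (Matrix.of fun j k : Fin n => ∫ x, tiltedGaussian s x * (hermiteMonic j).eval x *
      (hermiteMonic k).eval x) =
      diagonal (fun j : Fin n => √(hermiteNormSq j)) * (1 + (s - 1) • overlapMatrix n) *
        diagonal (fun j : Fin n => √(hermiteNormSq j)) := by
    ext j k
    have hj := hermiteNormSq_pos j
    have hk := hermiteNormSq_pos k
    rw [mul_diagonal, diagonal_mul, of_apply, integral_tiltedGaussian_mul_eval]
    simp only [Matrix.add_apply, Matrix.smul_apply, overlapMatrix, of_apply, overlap, smul_eq_mul]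
    by_cases hjk : j = k
    · subst hjk
      rw [one_apply_eq]
      have h1 := Real.mul_self_sqrt hj.le
      field_simp
      rw [Real.sq_sqrt hj.le]
      rfl
    · rw [one_apply_ne hjk, gaussInt_univ_hermiteMonic_of_ne (fun h => hjk (Fin.ext h))]
      field_simp
      ring
  rw [h, det_mul, det_mul, det_diagonal, mul_comm, ← mul_assoc, ← prod_mul_distrib]
  congr 1
  exact prod_congr rfl fun j _ => Real.mul_self_sqrt (hermiteNormSq_pos j).le

lemma normalisation_eq (n : ℕ) :
    normalisation n = (n.factorial : ℝ) * ∏ j : Fin n, hermiteNormSq j := by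
  have h := integral_weight_mul_pow_index n 1
  simpa [normalisation] using h

lemma normalisation_pos (n : ℕ) : 0 < normalisation n := by
  rw [normalisation_eq]
  have : 0 < ∏ j : Fin n, hermiteNormSq j := prod_pos fun j _ => hermiteNormSq_pos j
  positivity

/-- The probability generating function of the index is a determinant. -/
lemma sum_indexProb_mul_pow (n : ℕ) (s : ℝ) :
    ∑ k ∈ range (n + 1), indexProb k n * s ^ k = (1 + (s - 1) • overlapMatrix n).det := by
  have h1 : ∀ x : Fin n → ℝ, weight n x * s ^ index x =
      ∑ k ∈ range (n + 1), {x : Fin n → ℝ | index x = k}.indicator (weight n) x * s ^ k := by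
    intro x
    rw [sum_eq_single (index x)]
    · rw [Set.indicator_of_mem (by simp)]
    · intro k _ hk
      rw [Set.indicator_of_notMem (fun h => hk h.symm), zero_mul]
    · intro h
      exact absurd (mem_range.2 (Nat.lt_succ_of_le (index_le x))) h
  have hm : ∀ k, MeasurableSet {x : Fin n → ℝ | index x = k} := fun k =>
    measurable_index n (measurableSet_singleton k)
  have h2 := integral_weight_mul_pow_index n s
  simp only [h1] at h2
  rw [integral_finsetSum _ fun k _ => ((integrable_weight n).indicator (hm k)).mul_const _,
    ← normalisation_eq] at h2
  have hN := normalisation_pos n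
  apply mul_left_cancel₀ hN.ne'
  rw [← h2, mul_sum]
  refine sum_congr rfl fun k _ => ?_
  rw [integral_mul_const, integral_indicator (hm k), indexProb]
  field_simp

/-- For a real symmetric matrix, `det (1 + t A)`, `tr A` and `tr A²` in terms of its
eigenvalues. -/
lemma exists_eigenvalues {n : ℕ} {A : Matrix (Fin n) (Fin n) ℝ} (hA : A.IsHermitian) :
    ∃ μ : Fin n → ℝ, (∀ t : ℝ, (1 + t • A).det = ∏ i, (1 + t * μ i)) ∧
      A.trace = ∑ i, μ i ∧ (A * A).trace = ∑ i, μ i ^ 2 := by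
  refine ⟨hA.eigenvalues, ?_, ?_, ?_⟩
  all_goals
    have hs := hA.spectral_theorem
    obtain ⟨U, hU⟩ : ∃ U, U = hA.eigenvectorUnitary := ⟨_, rfl⟩
    obtain ⟨D, hD⟩ : ∃ D : Matrix (Fin n) (Fin n) ℝ, D = diagonal hA.eigenvalues := ⟨_, rfl⟩
    have hs' : A = Unitary.conjStarAlgAut ℝ _ U D := by rw [hU, hD]; exact hs
    have hUU : star (U : Matrix (Fin n) (Fin n) ℝ) * (U : Matrix (Fin n) (Fin n) ℝ) = 1 :=
      Unitary.coe_star_mul_self U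
  · intro t
    have h : 1 + t • A = Unitary.conjStarAlgAut ℝ _ U (1 + t • D) := by
      rw [map_add, map_one, map_smul, ← hs']
    rw [h, Unitary.conjStarAlgAut_apply, det_mul_comm, ← mul_assoc, hUU, one_mul, hD,
      ← diagonal_one, ← diagonal_smul, diagonal_add, det_diagonal]
    rfl
  · rw [congrArg trace hs', Unitary.conjStarAlgAut_apply, trace_mul_comm, ← mul_assoc, hUU, one_mul, hD,
      trace_diagonal]
  · have h : A * A = Unitary.conjStarAlgAut ℝ _ U (D * D) := by
      rw [map_mul, ← hs']
    rw [h, Unitary.conjStarAlgAut_apply, trace_mul_comm, ← mul_assoc, hUU, one_mul, hD,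
      diagonal_mul_diagonal, trace_diagonal]
    exact sum_congr rfl fun i _ => (sq _).symm

/-- The derivatives at `1` of `∏ i, (1 + μ i (X - 1))`. For a generating function of this form
they are the first two factorial moments, as for a sum of independent Bernoulli variables. -/
lemma derivatives_prod_eval_one {ι : Type*} (S : Finset ι) (μ : ι → ℝ) :
    (∏ i ∈ S, (1 + C (μ i) * (X - 1))).eval 1 = 1 ∧
    (derivative (∏ i ∈ S, (1 + C (μ i) * (X - 1)))).eval 1 = ∑ i ∈ S, μ i ∧
    (derivative (derivative (∏ i ∈ S, (1 + C (μ i) * (X - 1))))).eval 1 =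
      (∑ i ∈ S, μ i) ^ 2 - ∑ i ∈ S, μ i ^ 2 := by
  classical
  induction S using Finset.induction_on with
  | empty => simp
  | insert a S ha ih =>
    obtain ⟨h0, h1, h2⟩ := ih
    simp only [prod_insert ha, sum_insert ha]
    refine ⟨?_, ?_, ?_⟩
    · simp [h0]
    · simp [derivative_mul, h0, h1]
    · simp [derivative_mul, h1, h2]
      ring

lemma indexVariance_eq_trace (n : ℕ) :
    indexVariance n = (overlapMatrix n).trace - (overlapMatrix n * overlapMatrix n).trace := by
  have hA : (overlapMatrix n).IsHermitian := by
    ext j k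
    simp [overlapMatrix, overlap_comm]
  obtain ⟨μ, hdet, htr, htr2⟩ := exists_eigenvalues hA
  have hpoly : ∑ k ∈ range (n + 1), C (indexProb k n) * X ^ k =
      ∏ i, (1 + C (μ i) * (X - 1)) := by
    refine Polynomial.funext fun s => ?_
    have h := sum_indexProb_mul_pow n s
    rw [hdet] at h
    simp only [eval_finsetSum, eval_prod, eval_mul, eval_C, eval_pow, eval_X, eval_add, eval_one,
      eval_sub]
    rw [h]
    exact prod_congr rfl fun i _ => by ring
  obtain ⟨h0, h1, h2⟩ := derivatives_prod_eval_one univ μ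
  rw [← hpoly] at h0 h1 h2
  have e0 : ∑ k ∈ range (n + 1), indexProb k n = 1 := by
    simpa [eval_finsetSum] using h0
  have e1 : indexMean n = ∑ i, μ i := by
    rw [← h1, indexMean, derivative_sum, eval_finsetSum]
    refine sum_congr rfl fun k _ => ?_
    rw [derivative_C_mul, derivative_X_pow]
    simp only [eval_mul, eval_C, eval_pow, eval_X, one_pow]
    ring
  have e2 : ∑ k ∈ range (n + 1), (k : ℝ) * ((k : ℝ) - 1) * indexProb k n =
      (∑ i, μ i) ^ 2 - ∑ i, μ i ^ 2 := by
    rw [← h2, derivative_sum, derivative_sum, eval_finsetSum]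
    refine sum_congr rfl fun k _ => ?_
    cases k with
    | zero => simp
    | succ k =>
      simp [derivative_X_pow]
      ring
  have e3 : indexVariance n = ∑ k ∈ range (n + 1), (k : ℝ) * ((k : ℝ) - 1) * indexProb k n +
      (1 - 2 * indexMean n) * indexMean n +
        indexMean n ^ 2 * ∑ k ∈ range (n + 1), indexProb k n := by
    conv_rhs => rw [mul_sum]; enter [1, 2, 2]; rw [indexMean]
    rw [mul_sum, ← sum_add_distrib, ← sum_add_distrib, indexVariance]
    exact sum_congr rfl fun k _ => by ring
  rw [e3, e0, e1, e2, htr, htr2]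
  ring

lemma indexVariance_eq_sum (n : ℕ) : indexVariance n =
    ∑ j ∈ range n, overlap j j - ∑ j ∈ range n, ∑ k ∈ range n, overlap j k ^ 2 := by
  rw [indexVariance_eq_trace, ← Fin.sum_univ_eq_sum_range (fun j => overlap j j),
    ← Fin.sum_univ_eq_sum_range (fun j => ∑ k ∈ range n, overlap j k ^ 2)]
  congr 1
  refine sum_congr rfl fun j _ => ?_
  rw [← Fin.sum_univ_eq_sum_range (fun k => overlap j k ^ 2), diag_apply, mul_apply]
  refine sum_congr rfl fun k _ => ?_
  rw [overlapMatrix, of_apply, of_apply, overlap_comm k j, sq]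

lemma indexVariance_zero : indexVariance 0 = 0 := by
  simp [indexVariance_eq_sum]

lemma indexVariance_succ (n : ℕ) :
    indexVariance (n + 1) = indexVariance n + 1 / 4 - 2 * ∑ j ∈ range n, overlap j n ^ 2 := by
  simp only [indexVariance_eq_sum, sum_range_succ, sum_add_distrib, overlap_self,
    fun k => overlap_comm n k]
  ring

end GUEIndex

end

theorem mainTheorem1 :
    (∀ n m : ℕ, m = n / 2 →
      GUEIndex.indexVariance n =
          (n : ℝ) / 4 - (n : ℝ) / (2 * Real.pi ^ 2) *
            ∑ l ∈ Finset.range (m + 1), GUEIndex.gammaRatioSq l *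
              (GUEIndex.psi ((m : ℝ) + 1 / 2) - GUEIndex.psi ((m : ℝ) + 1)
                - GUEIndex.psi ((l : ℝ) + 1 / 2) + GUEIndex.psi ((l : ℝ) + 1)) ∧
      ∃ T : ℝ,
        HasSum (fun i : ℕ => GUEIndex.gammaRatioSq (m + 1 + i) *
          (GUEIndex.psi (((m + 1 + i : ℕ) : ℝ) + 1)
            - GUEIndex.psi (((m + 1 + i : ℕ) : ℝ) + 1 / 2))) T ∧
        GUEIndex.indexVariance n =
          (n : ℝ) / (2 * Real.pi ^ 2) *
            ((GUEIndex.psi ((m : ℝ) + 1) - GUEIndex.psi ((m : ℝ) + 1 / 2)) *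
              ∑ l ∈ Finset.range (m + 1), GUEIndex.gammaRatioSq l + T)) ∧
    HasSum (fun l : ℕ => GUEIndex.gammaRatioSq l *
      (GUEIndex.psi ((l : ℝ) + 1) - GUEIndex.psi ((l : ℝ) + 1 / 2)))
      (Real.pi ^ 2 / 2) := by
  refine ⟨fun n m hm => ?_, GUEIndex.hasSum_gammaRatioSq_mul_psiGap⟩
  refine GUEIndex.closed_formulas_of_variance _ n m ?_
  have h := GUEIndex.eq_evenRow_of_increment GUEIndex.indexVariance_zero
    GUEIndex.indexVariance_succ m
  obtain rfl | rfl : n = 2 * m ∨ n = 2 * m + 1 := by omega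
  · exact h.1
  · exact h.2
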